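/- Let $d\in\{-2,-7,-11,-15\}$, let $R$ be the ring of integers of $\mathbb{Q}(\sqrt d)$, put $\mathcal{L}_n=\{x\in R: x\overline{x}=n\}$ and $\mathcal{L}=\{0\}\cup\mathcal{L}_1\cup\mathcal{L}_2\cup\mathcal{L}_3\cup\mathcal{L}_4$. An $\mathcal{L}$-graph is a finite set of vertices together with a Hermitian matrix $A$, indexed by the vertices, with entries in $\mathcal{L}$ and diagonal entries (charges) in $\{0,1,-1\}$; a nonzero entry $A_{uv}$ with $u\ne v$ is an edge, of weight $A_{uv}\overline{A_{uv}}$. It is cyclotomic if all eigenvalues of $A$ lie in $[-2,2]$. Two $\mathcal{L}$-graphs with matrices $A$ and $B$ are equivalent if $B$ is obtained from one of $A,-A,\overline{A},-\overline{A}$ by conjugation by a diagonal matrix with entries $\pm1$ followed by a relabelling of the vertices. Let $k=L+1\ge 2$. An $\mathcal{L}$-graph on $2k$ vertices is of the form $\mathcal{T}_{2k}^4$ if its vertices can be named $t_1,\dots,t_L$, $b_1,\dots,b_L$, $p$, $q$ such that all vertices are uncharged, its edges of weight $1$ are exactly those joining each of $t_i,b_i$ to each of $t_{i+1},b_{i+1}$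 for $1\le i<L$, its edges of weight $2$ are exactly those joining $p$ to $t_1$ and $b_1$ and those joining $q$ to $t_L$ and $b_L$, and there are no other edges. For $d=-2$ let $\omega=\sqrt{-2}$, and for $d=-7$ let $\omega=\frac12+\frac{\sqrt{-7}}2$. Let $T_{2k}^4$ be the $\mathcal{L}$-graph of this form whose matrix $M$ satisfies $M_{t_i,t_{i+1}}=M_{t_i,b_{i+1}}=1$ and $M_{b_i,b_{i+1}}=M_{b_i,t_{i+1}}=-1$ for $1\le i<L$, $M_{t_1,p}=M_{b_1,p}=\omega$, $M_{t_L,q}=\omega$ and $M_{b_L,q}=-\omega$. For $d=-7$ let $T_{2k}^{4'}$ be defined in the same way, except that $M_{t_L,q}=\overline{\omega}$ and $M_{b_L,q}=-\overline{\omega}$. If $G$ is a cyclotomic $\mathcal{L}$-graph of the form $\mathcal{T}_{2k}^4$, where $k\ge2$, then either $d=-2$ and $G$ is equivalent to $T_{2k}^4$, or $d=-7$ and $G$ is equivalent to $T_{2k}^4$ or to $T_{2k}^{4'}$. (In particular no such $G$ exists for $d=-11$ or $d=-15$.) -/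

import Mathlib

open scoped ComplexConjugate

/-- The complex number `√d`, for a negative integer `d`. -/
noncomputable def sqrtNeg (d : ℤ) : ℂ := Complex.I * (Real.sqrt (-(d : ℝ)) : ℂ)

/-- The imaginary quadratic field `ℚ(√d)` inside `ℂ`. -/
noncomputable def quadField (d : ℤ) : IntermediateField ℚ ℂ :=
  IntermediateField.adjoin ℚ {sqrtNeg d}

/-- The ring of integers of `ℚ(√d)`, as a subset of `ℂ`. -/
def quadIntegers (d : ℤ) : Set ℂ := {z | z ∈ quadField d ∧ IsIntegral ℤ z}

/-- `𝓛ₙ`: the elements of norm `n` in the ring of integers of `ℚ(√d)`. -/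
def normLabels (d : ℤ) (n : ℕ) : Set ℂ := {z | z ∈ quadIntegers d ∧ z * conj z = n}

/-- `𝓛 = {0} ∪ 𝓛₁ ∪ 𝓛₂ ∪ 𝓛₃ ∪ 𝓛₄`. -/
def labelSet (d : ℤ) : Set ℂ :=
  {0} ∪ normLabels d 1 ∪ normLabels d 2 ∪ normLabels d 3 ∪ normLabels d 4

/-- A (charged) `𝓛`-graph on the vertex set `V`, given by its adjacency matrix: for `u ≠ v` a
nonzero entry `(u, v)` is an edge with that label (read from `u` to `v`, its conjugate being read
from `v` to `u`), and the diagonal entries are the charges of the vertices. -/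
structure LGraph (d : ℤ) (V : Type*) where
  /-- the adjacency matrix -/
  adj : Matrix V V ℂ
  isHermitian : adj.IsHermitian
  label_mem : ∀ u v, adj u v ∈ labelSet d
  charge_mem : ∀ v, adj v v = 0 ∨ adj v v = 1 ∨ adj v v = -1

namespace LGraph

variable {d : ℤ} {V W : Type*}

/-- An `𝓛`-graph is cyclotomic if all eigenvalues of its adjacency matrix lie in `[-2, 2]`. -/
def IsCyclotomic [Fintype V] [DecidableEq V] (G : LGraph d V) : Prop :=
  ∀ i, G.isHermitian.eigenvalues i ∈ Set.Icc (-2 : ℝ) 2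

end LGraph

/-- `B` is obtained from `A` by a signed permutation: switching at some of the vertices of `A`
(conjugation by a diagonal matrix of signs), followed by a relabelling of the vertices. -/
def StronglyEquivalent {V W : Type*} [Fintype V] [DecidableEq V]
    (A : Matrix V V ℂ) (B : Matrix W W ℂ) : Prop :=
  ∃ (σ : W ≃ V) (s : V → ℂ), (∀ v, s v = 1 ∨ s v = -1) ∧
    B = (Matrix.diagonal s * A * Matrix.diagonal s).submatrix σ σ

/-- Two `𝓛`-graphs `G`, `H` are equivalent if the matrix of `H` is strongly equivalent to
one of `A`, `-A`, `Ā`, `-Ā`, where `A` is the matrix of `G`. -/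
def LGraph.Equivalent {d : ℤ} {V W : Type*} [Fintype V] [DecidableEq V]
    (G : LGraph d V) (H : LGraph d W) : Prop :=
  StronglyEquivalent G.adj H.adj ∨ StronglyEquivalent (-G.adj) H.adj ∨
    StronglyEquivalent (G.adj.map conj) H.adj ∨ StronglyEquivalent (-(G.adj.map conj)) H.adj

/-- The `2k` vertices, `k = L + 1`, of the form `𝒯_{2k}^4`. The vertices `Sum.inl (r, i)` form a
cylinder with `L` columns: `r = 0` is the top row (vertices `1, …, L`), `r = 1` the bottom row
(vertices `L + 1, …, 2L`), and `i` is the column, counted from `0`. The vertices `Sum.inr 0` and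
`Sum.inr 1` are the left and the right end vertex (`2L + 1` and `2L + 2`). -/
abbrev TVertex (L : ℕ) : Type := (Fin 2 × Fin L) ⊕ Fin 2

/-- The weight between two vertices of the form `𝒯_{2k}^4` (`0` for no edge): weight `1` between
any two vertices in consecutive columns, and weight `2` between an end vertex and both vertices of
the column at that end. -/
def formWeight (L : ℕ) : TVertex L → TVertex L → ℕ
  | .inl (_, i), .inl (_, j) => if i.val + 1 = j.val ∨ j.val + 1 = i.val then 1 else 0
  | .inl (_, i), .inr e => if (if e = 0 then i.val = 0 else i.val + 1 = L) then 2 else 0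
  | .inr e, .inl (_, i) => if (if e = 0 then i.val = 0 else i.val + 1 = L) then 2 else 0
  | .inr _, .inr _ => 0

/-- `G` is of the form `𝒯_{2k}^4`: its vertices can be numbered so that all vertices are uncharged
and every edge has the prescribed weight (the weight of a label `x` being its norm `x x̄`). -/
def LGraph.IsOfFormT {d : ℤ} {V : Type*} (G : LGraph d V) (k : ℕ) : Prop :=
  ∃ e : TVertex (k - 1) ≃ V, ∀ u v,
    G.adj (e u) (e v) * conj (G.adj (e u) (e v)) = formWeight (k - 1) u v

/-- The sign attached to a row of the cylinder: `1` for the top row, `-1` for the bottom row. -/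
def rowSign (r : Fin 2) : ℂ := if r = 0 then 1 else -1

/-- The labels inside the cylinder: the edges leaving a top vertex to the right have sign `1`, the
edges leaving a bottom vertex to the right have sign `-1`. -/
def cylinderMatrix (L : ℕ) : Matrix (Fin 2 × Fin L) (Fin 2 × Fin L) ℂ := fun u v =>
  if u.2.val + 1 = v.2.val then rowSign u.1
  else if v.2.val + 1 = u.2.val then rowSign v.1
  else 0

/-- The labels of the edges from the cylinder to the end vertices: both edges to the left end vertex
are labelled `α`; the edges from the last top and bottom vertex to the right end vertex are
labelled `β` and `-β`. -/
def endMatrix (L : ℕ) (α β : ℂ) : Matrix (Fin 2 × Fin L) (Fin 2) ℂ := fun u e =>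
  if e = 0 then (if u.2.val = 0 then α else 0)
  else (if u.2.val + 1 = L then rowSign u.1 * β else 0)

/-- The full adjacency matrix with left end label `α` and right end label `β`. -/
noncomputable def tMatrix (L : ℕ) (α β : ℂ) : Matrix (TVertex L) (TVertex L) ℂ :=
  Matrix.fromBlocks (cylinderMatrix L) (endMatrix L α β) (endMatrix L α β).conjTranspose 0

theorem neg_mem_normLabels {d : ℤ} {n : ℕ} {z : ℂ} (h : z ∈ normLabels d n) :
    -z ∈ normLabels d n :=
  ⟨⟨neg_mem h.1.1, h.1.2.neg⟩, by simpa using h.2⟩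

theorem conj_mem_normLabels {d : ℤ} {n : ℕ} {z : ℂ} (h : z ∈ normLabels d n) :
    conj z ∈ normLabels d n := by
  by_cases h0 : z = 0
  · subst h0; simpa using h
  refine ⟨⟨?_, ?_⟩, by simpa [mul_comm] using h.2⟩
  · have : conj z = (n : ℂ) * z⁻¹ := by rw [← h.2]; field_simp
    rw [this]
    exact mul_mem (natCast_mem _ n) (inv_mem h.1.1)
  · exact h.1.2.map (Complex.conjAe.toAlgHom.restrictScalars ℤ)

theorem one_mem_normLabels (d : ℤ) : (1 : ℂ) ∈ normLabels d 1 :=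
  ⟨⟨one_mem _, isIntegral_one⟩, by simp⟩

theorem rowSign_mem (d : ℤ) (r : Fin 2) : rowSign r ∈ normLabels d 1 := by
  unfold rowSign
  split_ifs
  · exact one_mem_normLabels d
  · exact neg_mem_normLabels (one_mem_normLabels d)

theorem zero_mem_labelSet (d : ℤ) : (0 : ℂ) ∈ labelSet d := by simp [labelSet]

theorem labelSet_of_one {d : ℤ} {z : ℂ} (h : z ∈ normLabels d 1) : z ∈ labelSet d := by
  simp [labelSet, h]

theorem labelSet_of_two {d : ℤ} {z : ℂ} (h : z ∈ normLabels d 2) : z ∈ labelSet d := by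
  simp [labelSet, h]

theorem cylinderMatrix_mem (d : ℤ) (L : ℕ) (u v : Fin 2 × Fin L) :
    cylinderMatrix L u v ∈ labelSet d := by
  unfold cylinderMatrix
  split_ifs
  · exact labelSet_of_one (rowSign_mem d _)
  · exact labelSet_of_one (rowSign_mem d _)
  · exact zero_mem_labelSet d

theorem endMatrix_mem {d : ℤ} (L : ℕ) {α β : ℂ} (hα : α ∈ normLabels d 2)
    (hβ : β ∈ normLabels d 2) (u : Fin 2 × Fin L) (e : Fin 2) :
    endMatrix L α β u e = 0 ∨ endMatrix L α β u e ∈ normLabels d 2 := by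
  unfold endMatrix rowSign
  split_ifs <;> simp [hα, hβ, neg_mem_normLabels]

theorem rowSign_conj (r : Fin 2) : conj (rowSign r) = rowSign r := by
  unfold rowSign; split_ifs <;> simp

theorem cylinderMatrix_isHermitian (L : ℕ) : (cylinderMatrix L).IsHermitian := by
  ext u v
  simp only [Matrix.conjTranspose_apply, cylinderMatrix]
  split_ifs
  · omega
  all_goals simp [rowSign_conj]

theorem tMatrix_isHermitian (L : ℕ) (α β : ℂ) : (tMatrix L α β).IsHermitian :=
  Matrix.IsHermitian.fromBlocks (cylinderMatrix_isHermitian L) rfl (by simp)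

/-- The `𝓛`-graph with the signs of `cylinderMatrix` and end labels `α, β ∈ 𝓛₂`. -/
noncomputable def tGraph (d : ℤ) (L : ℕ) (α β : ℂ) (hα : α ∈ normLabels d 2)
    (hβ : β ∈ normLabels d 2) : LGraph d (TVertex L) where
  adj := tMatrix L α β
  isHermitian := tMatrix_isHermitian L α β
  label_mem := by
    rintro (u | e) (v | f)
    · exact cylinderMatrix_mem d L u v
    · rcases endMatrix_mem L hα hβ u f with h | h
      · simpa [tMatrix, h] using zero_mem_labelSet d
      · simpa [tMatrix] using labelSet_of_two h
    · rcases endMatrix_mem L hα hβ v e with h | h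
      · simpa [tMatrix, h] using zero_mem_labelSet d
      · simpa [tMatrix] using labelSet_of_two (conj_mem_normLabels h)
    · simpa [tMatrix] using zero_mem_labelSet d
  charge_mem := by
    rintro (u | e) <;> left <;> simp [tMatrix, cylinderMatrix]

/-- `ω = √-2` for `d = -2` and `ω = 1/2 + √-7/2` for `d = -7`. -/
noncomputable def omega (d : ℤ) : ℂ := if d = -2 then sqrtNeg d else (1 + sqrtNeg d) / 2

theorem sqrtNeg_sq {d : ℤ} (hd : d ≤ 0) : sqrtNeg d * sqrtNeg d = d := by
  have h : (0 : ℝ) ≤ -(d : ℝ) := by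
    have : (d : ℝ) ≤ 0 := by exact_mod_cast hd
    linarith
  have h2 : ((Real.sqrt (-(d : ℝ)) : ℝ) : ℂ) * (Real.sqrt (-(d : ℝ)) : ℝ) = -(d : ℂ) := by
    rw [← Complex.ofReal_mul, Real.mul_self_sqrt h]; simp
  unfold sqrtNeg
  linear_combination (Complex.I * Complex.I) * h2 - (d : ℂ) * Complex.I_mul_I

theorem sqrtNeg_conj (d : ℤ) : conj (sqrtNeg d) = -sqrtNeg d := by
  simp [sqrtNeg]

theorem sqrtNeg_mem (d : ℤ) : sqrtNeg d ∈ quadField d :=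
  IntermediateField.subset_adjoin ℚ _ rfl

theorem omega_mem {d : ℤ} (hd : d = -2 ∨ d = -7) : omega d ∈ normLabels d 2 := by
  rcases hd with rfl | rfl
  · have h := sqrtNeg_sq (d := -2) (by norm_num)
    push_cast at h
    refine ⟨⟨by simpa [omega] using sqrtNeg_mem (-2), ?_⟩, ?_⟩
    · refine ⟨Polynomial.X ^ 2 + Polynomial.C 2, by monicity!, ?_⟩
      simp only [omega, if_true, Polynomial.eval₂_add, Polynomial.eval₂_pow, Polynomial.eval₂_X,
        Polynomial.eval₂_C]
      simp only [map_ofNat]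
      linear_combination h
    · simp only [omega, if_true, sqrtNeg_conj]
      push_cast
      linear_combination -h
  · have h := sqrtNeg_sq (d := -7) (by norm_num)
    push_cast at h
    have ho : omega (-7) = (1 + sqrtNeg (-7)) / 2 := by simp [omega]
    refine ⟨⟨?_, ?_⟩, ?_⟩
    · rw [ho]
      exact div_mem (add_mem (one_mem _) (sqrtNeg_mem _)) (ofNat_mem _ 2)
    · refine ⟨Polynomial.X ^ 2 - Polynomial.X + Polynomial.C 2, by monicity!, ?_⟩
      simp only [ho, Polynomial.eval₂_add, Polynomial.eval₂_sub, Polynomial.eval₂_pow,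
        Polynomial.eval₂_X, Polynomial.eval₂_C]
      simp only [map_ofNat]
      linear_combination h / 4
    · simp only [ho, map_div₀, map_add, map_one, sqrtNeg_conj, map_ofNat]
      push_cast
      linear_combination -h / 4

/-- The `2k`-vertex `𝓛`-graph `T_{2k}^4`, with end labels `ω, ω` on the left and `ω, -ω` on the
right. -/
noncomputable def T4 (d : ℤ) (hd : d = -2 ∨ d = -7) (k : ℕ) : LGraph d (TVertex (k - 1)) :=
  tGraph d (k - 1) (omega d) (omega d) (omega_mem hd) (omega_mem hd)

/-- The `2k`-vertex `𝓛`-graph `T_{2k}^{4'}`, with end labels `ω, ω` on the left and `ω̄, -ω̄` on the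
right. -/
noncomputable def T4' (d : ℤ) (hd : d = -2 ∨ d = -7) (k : ℕ) : LGraph d (TVertex (k - 1)) :=
  tGraph d (k - 1) (omega d) (conj (omega d)) (omega_mem hd) (conj_mem_normLabels (omega_mem hd))

/-!
Every vertex of the form `𝒯` has weighted degree `4`, so the trace of `A²` is `4` times the number of
vertices. As no eigenvalue exceeds `2` in absolute value, all of them are `±2` and `A² = 4`
(`sq_eq_four_of_eigenvalues_mem_Icc`): distinct rows of `A` are orthogonal.

The labels of norm `1` are `±1`, and those of norm `2` are `±ω, ±ω̄` for `d = -2, -7` and do not exist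
for `d = -11, -15`, which excludes these two values (`mem_normLabels_two`). It then suffices to use
the orthogonality of the rows of the two vertices in each column. If the labels `a, a'` from the first
column to the left end are equal up to sign, switch to make them equal. The neighbours on the left
contribute `2` to the inner product of the two rows of this column, hence those on the right contribute
`-2`, and the labels leaving the bottom vertex to the right are the negatives of those leaving the top
vertex. Switching the next column makes the latter equal to `1`, so the neighbours on the left of that
column contribute `2` again, and so on up to the right end (`columnSign_mul_eq_neg`,
`stronglyEquivalent_tMatrix`).

The orthogonality of the rows of the first column gives `a' = ±a` if there are at least two columns.
With one column the graph is a quadrilateral, and either `a' = ±a` or this holds after its two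
diagonals, the column and the pair of ends, are exchanged (`sq_eq_or_sq_eq_of_orthogonal`). Switching
the ends and conjugating turns the left end label into `ω`, and the right one into `ω` or `ω̄`, where
`ω̄ = -ω` for `d = -2`.
-/

/-! ### Labels of norm `1` and `2` -/

theorem exists_rat_of_mem_quadField {d : ℤ} (hd : d < 0) {z : ℂ} (hz : z ∈ quadField d) :
    ∃ x y : ℚ, z = x + y * sqrtNeg d := by
  have hs := sqrtNeg_sq hd.le
  induction hz using IntermediateField.adjoin_induction with
  | mem z hz => exact ⟨0, 1, by simpa using hz⟩
  | algebraMap x => exact ⟨x, 0, by simp⟩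
  | add z w _ _ hz hw =>
    obtain ⟨a, b, rfl⟩ := hz
    obtain ⟨a', b', rfl⟩ := hw
    exact ⟨a + a', b + b', by push_cast; ring⟩
  | mul z w _ _ hz hw =>
    obtain ⟨a, b, rfl⟩ := hz
    obtain ⟨a', b', rfl⟩ := hw
    exact ⟨a * a' + d * (b * b'), a * b' + b * a', by
      push_cast; linear_combination (b : ℂ) * b' * hs⟩
  | inv z _ hz =>
    obtain ⟨a, b, rfl⟩ := hz
    by_cases h : a ^ 2 - d * b ^ 2 = 0
    · have hd' : (d : ℚ) < 0 := by exact_mod_cast hd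
      have hb : b = 0 := by
        by_contra hb
        have : 0 < b ^ 2 := by positivity
        nlinarith [sq_nonneg a]
      have ha : a = 0 := by simpa [hb] using h
      exact ⟨0, 0, by simp [ha, hb]⟩
    · refine ⟨a / (a ^ 2 - d * b ^ 2), -b / (a ^ 2 - d * b ^ 2), inv_eq_of_mul_eq_one_right ?_⟩
      have h' : ((a : ℂ) ^ 2 - d * b ^ 2) ≠ 0 := by exact_mod_cast h
      push_cast
      rw [div_mul_eq_mul_div, ← add_div, mul_div_assoc', div_eq_one_iff_eq h']
      linear_combination -(b : ℂ) ^ 2 * hs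

/-- A label of norm `n` is `(a + b √d) / 2`, where `a` is the trace, hence an integer, and
`a² - d b² = 4 n`. That `b` is rational is enough to list the labels of norm `1` and `2`, by
`isSquare_of_sq_sub_mul_sq_eq`. -/
theorem exists_half_of_mem_normLabels {d : ℤ} (hd : d < 0) {n : ℕ} {z : ℂ}
    (hz : z ∈ normLabels d n) :
    ∃ (a : ℤ) (b : ℚ), z = (a + b * sqrtNeg d) / 2 ∧ (a : ℚ) ^ 2 - d * b ^ 2 = 4 * n := by
  obtain ⟨⟨hK, hint⟩, hn⟩ := hz
  have hs := sqrtNeg_sq hd.le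
  obtain ⟨x, y, rfl⟩ := exists_rat_of_mem_quadField hd hK
  have htr : IsIntegral ℤ (algebraMap ℚ ℂ (2 * x)) := by
    have htrace : algebraMap ℚ ℂ (2 * x) = (x + y * sqrtNeg d) + conj (x + y * sqrtNeg d) := by
      simp only [map_mul, map_ofNat, eq_ratCast, map_add, map_ratCast, sqrtNeg_conj]
      ring
    rw [htrace]
    exact hint.add (hint.map (Complex.conjAe.toAlgHom.restrictScalars ℤ))
  rw [isIntegral_algebraMap_iff (algebraMap ℚ ℂ).injective, IsIntegrallyClosed.isIntegral_iff]
    at htr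
  obtain ⟨a, ha⟩ := htr
  have ha : (a : ℚ) = 2 * x := by simpa using ha
  have haC : (a : ℂ) = 2 * x := by exact_mod_cast congrArg (fun q : ℚ => (q : ℂ)) ha
  refine ⟨a, 2 * y, ?_, ?_⟩
  · push_cast; rw [haC]; ring
  · have h : (((a : ℚ) ^ 2 - d * (2 * y) ^ 2 : ℚ) : ℂ) = ((4 * n : ℚ) : ℂ) := by
      push_cast
      rw [haC, ← hn]
      simp only [map_add, map_mul, sqrtNeg_conj, map_ratCast]
      linear_combination 4 * (y : ℂ) ^ 2 * hs
    exact_mod_cast h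

/-- For given `a` and `m` this leaves a decidable condition on integers. -/
theorem isSquare_of_sq_sub_mul_sq_eq {d a m : ℤ} {b : ℚ} (h : (a : ℚ) ^ 2 - d * b ^ 2 = m) :
    IsSquare (-d * (m - a ^ 2)) := by
  rw [← Rat.isSquare_intCast_iff]
  exact ⟨d * b, by push_cast; rw [← h]; ring⟩

theorem eq_one_or_neg_one_of_mem_normLabels_one {d : ℤ}
    (hd : d = -2 ∨ d = -7 ∨ d = -11 ∨ d = -15) {z : ℂ} (hz : z ∈ normLabels d 1) :
    z = 1 ∨ z = -1 := by
  have hd0 : d < 0 := by omega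
  obtain ⟨a, b, rfl, h⟩ := exists_half_of_mem_normLabels hd0 hz
  have hdQ : (d : ℚ) < 0 := by exact_mod_cast hd0
  have ha : a ^ 2 ≤ 4 := by
    have : (a : ℚ) ^ 2 ≤ 4 := by push_cast at h; nlinarith [sq_nonneg b]
    exact_mod_cast this
  have h1 : -2 ≤ a := by nlinarith
  have h2 : a ≤ 2 := by nlinarith
  have hsq := isSquare_of_sq_sub_mul_sq_eq (m := 4) (by simpa using h)
  have h4 : a = 2 ∨ a = -2 := by
    clear h ha hz hd0 hdQ
    rcases hd with rfl | rfl | rfl | rfl <;> interval_cases a <;> revert hsq <;> decide +kernel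
  have hb : b = 0 := by
    have h4' : (a : ℚ) ^ 2 = 4 := by rcases h4 with rfl | rfl <;> norm_num
    have : (d : ℚ) * b ^ 2 = 0 := by push_cast at h; linarith
    simpa [hdQ.ne] using this
  rcases h4 with rfl | rfl <;> simp [hb]

/-- In particular there are no labels of weight `2` for `d = -11` and `d = -15`. -/
theorem mem_normLabels_two {d : ℤ} (hd : d = -2 ∨ d = -7 ∨ d = -11 ∨ d = -15) {z : ℂ}
    (hz : z ∈ normLabels d 2) :
    (d = -2 ∨ d = -7) ∧ (z = omega d ∨ z = -omega d ∨
      z = conj (omega d) ∨ z = -conj (omega d)) := by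
  have hd0 : d < 0 := by omega
  obtain ⟨a, b, rfl, h⟩ := exists_half_of_mem_normLabels hd0 hz
  have hdQ : (d : ℚ) < 0 := by exact_mod_cast hd0
  have ha : a ^ 2 ≤ 8 := by
    have : (a : ℚ) ^ 2 ≤ 8 := by push_cast at h; nlinarith [sq_nonneg b]
    exact_mod_cast this
  have h1 : -2 ≤ a := by nlinarith
  have h2 : a ≤ 2 := by nlinarith
  have hsq := isSquare_of_sq_sub_mul_sq_eq (m := 8) (by rw [h]; norm_num)
  have hda : (d = -2 ∧ a = 0) ∨ (d = -7 ∧ (a = 1 ∨ a = -1)) := by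
    clear h ha hz hd0 hdQ
    rcases hd with rfl | rfl | rfl | rfl <;> interval_cases a <;> revert hsq <;> decide +kernel
  rcases hda with ⟨rfl, rfl⟩ | ⟨rfl, ha⟩
  · have hb : b = 2 ∨ b = -2 := sq_eq_sq_iff_eq_or_eq_neg.1 (by push_cast at h; linarith)
    refine ⟨.inl rfl, ?_⟩
    rcases hb with rfl | rfl
    · left; simp [omega]
    · right; left; simp [omega]; ring
  · have hb : b = 1 ∨ b = -1 := sq_eq_sq_iff_eq_or_eq_neg.1 (by
      have : (a : ℚ) ^ 2 = 1 := by rcases ha with rfl | rfl <;> norm_num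
      push_cast at h; linarith)
    refine ⟨.inr rfl, ?_⟩
    have ho : omega (-7) = (1 + sqrtNeg (-7)) / 2 := by simp [omega]
    have hc : conj (omega (-7)) = (1 - sqrtNeg (-7)) / 2 := by
      rw [ho]; simp [sqrtNeg_conj, sub_eq_add_neg, map_ofNat]
    rw [hc, ho]
    rcases ha with rfl | rfl <;> rcases hb with rfl | rfl
    · left; push_cast; ring
    · right; right; left; push_cast; ring
    · right; right; right; push_cast; ring
    · right; left; push_cast; ring

theorem mem_normLabels_of_mem_labelSet {d : ℤ} {n : ℕ} {z : ℂ} (hn : n ≠ 0) (hz : z ∈ labelSet d)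
    (h : z * conj z = n) : z ∈ normLabels d n := by
  have key : ∀ m : ℕ, z ∈ normLabels d m → z ∈ normLabels d n := fun m hm => by
    have : m = n := by exact_mod_cast hm.2.symm.trans h
    exact this ▸ hm
  rcases hz with (((hz | hz) | hz) | hz) | hz
  · rw [Set.mem_singleton_iff.1 hz, zero_mul] at h
    exact absurd (by exact_mod_cast h.symm) hn
  all_goals exact key _ hz

theorem omega_sq_add_conj_sq_ne_zero {d : ℤ} (hd : d = -2 ∨ d = -7) :
    omega d ^ 2 + conj (omega d) ^ 2 ≠ 0 := by
  have hs := sqrtNeg_sq (d := d) (by omega)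
  rcases hd with rfl | rfl
  · have : omega (-2) ^ 2 + conj (omega (-2)) ^ 2 = -4 := by
      simp only [omega, if_true, sqrtNeg_conj]
      push_cast at hs
      linear_combination 2 * hs
    rw [this]; norm_num
  · have : omega (-7) ^ 2 + conj (omega (-7)) ^ 2 = -3 := by
      have ho : omega (-7) = (1 + sqrtNeg (-7)) / 2 := by simp [omega]
      simp only [ho, map_div₀, map_add, map_one, sqrtNeg_conj, map_ofNat]
      push_cast at hs
      linear_combination hs / 2
    rw [this]; norm_num

/-! ### The square of the matrix -/

/-- Each eigenvalue has square at most `4`, while the squares of the eigenvalues add up to the trace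
of `A²`, which is `4` times their number; so all the squares equal `4`. -/
theorem sq_eq_four_of_eigenvalues_mem_Icc {V : Type*} [Fintype V] [DecidableEq V]
    {A : Matrix V V ℂ} (hA : A.IsHermitian) (hev : ∀ i, hA.eigenvalues i ∈ Set.Icc (-2 : ℝ) 2)
    (hrow : ∀ u, ∑ v, A u v * conj (A u v) = 4) : A * A = 4 := by
  have hsq : A * A = Unitary.conjStarAlgAut ℂ _ hA.eigenvectorUnitary
      (Matrix.diagonal fun i => ((hA.eigenvalues i : ℂ)) ^ 2) := by
    conv_lhs => rw [hA.spectral_theorem, ← map_mul, Matrix.diagonal_mul_diagonal]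
    congr 2
    ext i
    simp [sq]
  have htr : (A * A).trace = ∑ i, ((hA.eigenvalues i : ℂ)) ^ 2 := by
    rw [hsq, Unitary.conjStarAlgAut_apply, Matrix.trace_mul_cycle]
    simp [Matrix.trace]
  have htr' : (A * A).trace = ∑ _i : V, (4 : ℂ) := by
    simp only [Matrix.trace, Matrix.diag, Matrix.mul_apply]
    refine Finset.sum_congr rfl fun u _ => ?_
    rw [← hrow u]
    exact Finset.sum_congr rfl fun v _ => by rw [← hA.apply v u]; rfl
  have hsum : ∑ i, (hA.eigenvalues i) ^ 2 = ∑ _i : V, (4 : ℝ) := by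
    have := htr.symm.trans htr'
    exact_mod_cast this
  have heq := (Finset.sum_eq_sum_iff_of_le fun i _ => by
    have h := hev i
    nlinarith [h.1, h.2]).1 hsum
  have : (Matrix.diagonal fun i => ((hA.eigenvalues i : ℂ)) ^ 2) = (4 : Matrix V V ℂ) := by
    rw [← Matrix.diagonal_ofNat 4]
    congr 1
    ext i
    show ((hA.eigenvalues i : ℂ)) ^ 2 = 4
    exact_mod_cast heq i (Finset.mem_univ i)
  rw [hsq, this]
  exact map_ofNat _ 4

theorem submatrix_mul_self_eq_four {V W : Type*} [Fintype V] [DecidableEq V] [Fintype W]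
    [DecidableEq W] {A : Matrix V V ℂ} (h : A * A = 4) (e : W ≃ V) :
    A.submatrix e e * A.submatrix e e = 4 := by
  rw [Matrix.submatrix_mul_equiv, h, ← Matrix.diagonal_ofNat 4, ← Matrix.diagonal_ofNat 4,
    Matrix.submatrix_diagonal_equiv]
  rfl

/-! ### Sums over neighbours, and weighted degrees -/

theorem sum_adjacent_columns {L : ℕ} (f : Fin L → ℂ) {i : ℕ} (hi : i < L)
    (hf : ∀ j : Fin L, ¬ (i + 1 = j.val ∨ j.val + 1 = i) → f j = 0) :
    ∑ j, f j = (if h : 0 < i then f ⟨i - 1, by omega⟩ else 0) +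
      (if h : i + 1 < L then f ⟨i + 1, h⟩ else 0) := by
  have hsplit : ∀ j : Fin L, f j =
      (if j.val + 1 = i then f j else 0) + (if i + 1 = j.val then f j else 0) := by
    intro j
    by_cases h1 : j.val + 1 = i
    · rw [if_pos h1, if_neg (by omega), add_zero]
    · by_cases h2 : i + 1 = j.val
      · rw [if_neg h1, if_pos h2, zero_add]
      · rw [if_neg h1, if_neg h2, hf j (by tauto), zero_add]
  rw [Finset.sum_congr rfl fun j _ => hsplit j, Finset.sum_add_distrib]
  congr 1
  · split_ifs with h
    · rw [Finset.sum_eq_single ⟨i - 1, by omega⟩]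
      · rw [if_pos (by simp; omega)]
      · intro j _ hj
        rw [if_neg fun h' => hj (Fin.ext (by simp; omega))]
      · simp
    · exact Finset.sum_eq_zero fun j _ => if_neg (by omega)
  · split_ifs with h
    · rw [Finset.sum_eq_single ⟨i + 1, h⟩]
      · rw [if_pos rfl]
      · intro j _ hj
        rw [if_neg fun h' => hj (Fin.ext (by simp; omega))]
      · simp
    · exact Finset.sum_eq_zero fun j _ => if_neg (by omega)

/-- A sum over all vertices of a function supported on the neighbours of a vertex in column `i`. -/
theorem sum_neighbours {L : ℕ} (F : TVertex L → ℂ) (r : Fin 2) {i : ℕ} (hi : i < L)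
    (hF : ∀ w, formWeight L (.inl (r, ⟨i, hi⟩)) w = 0 → F w = 0) :
    ∑ w, F w =
      (if h : 0 < i then F (.inl (0, ⟨i - 1, by omega⟩)) + F (.inl (1, ⟨i - 1, by omega⟩))
        else F (.inr 0)) +
      (if h : i + 1 < L then F (.inl (0, ⟨i + 1, h⟩)) + F (.inl (1, ⟨i + 1, h⟩))
        else F (.inr 1)) := by
  have hcol : ∀ r' : Fin 2, ∀ j : Fin L, ¬ (i + 1 = j.val ∨ j.val + 1 = i) →
      F (.inl (r', j)) = 0 := fun r' j hj => hF _ (by simp [formWeight, hj])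
  have hp : 0 < i → F (.inr 0) = 0 := fun h => hF _ (by simp [formWeight]; omega)
  have hq : i + 1 < L → F (.inr 1) = 0 := fun h => hF _ (by simp [formWeight]; omega)
  rw [Fintype.sum_sum_type, Fintype.sum_prod_type]
  simp only [Fin.sum_univ_two]
  rw [sum_adjacent_columns _ hi (hcol 0), sum_adjacent_columns _ hi (hcol 1)]
  split_ifs with h1 h2 h2
  · rw [hp h1, hq h2]; ring
  · rw [hp h1]; ring
  · rw [hq h2]; ring
  · ring

/-- Every vertex of the form `𝒯` has weighted degree `4`. -/
theorem sum_formWeight {L : ℕ} (hL : 0 < L) (u : TVertex L) :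
    ∑ v, (formWeight L u v : ℂ) = 4 := by
  rcases u with ⟨r, i⟩ | e
  · rw [sum_neighbours _ r i.2 fun w hw => by exact_mod_cast hw]
    have hi := i.2
    by_cases h1 : 0 < i.val <;> by_cases h2 : i.val + 1 < L
    · simp [formWeight, h1, h2, Nat.sub_add_cancel h1]; norm_num
    · have : i.val + 1 = L := by omega
      simp [formWeight, h1, this, Nat.sub_add_cancel h1]; norm_num
    · have : i.val = 0 := by omega
      simp [formWeight, this] at h2 ⊢
      simp [h2]; norm_num
    · have h3 : i.val = 0 := by omega
      have h4 : L = 1 := by omega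
      simp [formWeight, h3, h4]; norm_num
  · rw [Fintype.sum_sum_type, Fintype.sum_prod_type]
    have key : ∀ i₀ : Fin L, ∑ j : Fin L, (if j = i₀ then (2 : ℂ) else 0) = 2 := by simp
    fin_cases e
    · have := key ⟨0, hL⟩
      simp only [Fin.ext_iff] at this
      simp [formWeight, this]; norm_num
    · have := key ⟨L - 1, by omega⟩
      simp only [Fin.ext_iff] at this
      have h : ∀ j : ℕ, j + 1 = L ↔ j = L - 1 := fun j => by omega
      simp [formWeight, h, this]; norm_num

/-! ### Propagation of signs along the cylinder -/

theorem apply_eq_zero_of_formWeight {L : ℕ} {A : Matrix (TVertex L) (TVertex L) ℂ}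
    (hw : ∀ u v, A u v * conj (A u v) = formWeight L u v) {u v : TVertex L}
    (h : formWeight L u v = 0) : A u v = 0 := by
  have := hw u v
  rw [h] at this
  simpa using this

/-- The switching signs of a cylinder, column by column. Here `n r r' i` is the label from row `r`
of column `i` to row `r'` of column `i + 1`, and `τ` is the sign of the bottom vertex of the first
column; the later signs are chosen so that all labels leaving the top row become `1`. -/
def columnSign (n : Fin 2 → Fin 2 → ℕ → ℂ) (τ : ℂ) : ℕ → Fin 2 → ℂ
  | 0, r => if r = 0 then 1 else τ
  | i + 1, r => columnSign n τ i 0 * n 0 r i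

theorem columnSign_eq_one_or {n : Fin 2 → Fin 2 → ℕ → ℂ} {τ : ℂ}
    (hn : ∀ r r' i, n r r' i = 1 ∨ n r r' i = -1) (hτ : τ = 1 ∨ τ = -1) (i : ℕ) :
    ∀ r, columnSign n τ i r = 1 ∨ columnSign n τ i r = -1 := by
  induction i with
  | zero => intro r; simp only [columnSign]; split_ifs <;> simp [hτ]
  | succ i ih =>
    intro r
    rcases ih 0 with h | h <;> rcases hn 0 r i with h' | h' <;> simp [columnSign, h, h']

theorem signs_mul_eq_neg {x₀ x₁ y₀ y₁ τ₀ τ₁ : ℂ} (hx₀ : x₀ = 1 ∨ x₀ = -1) (hx₁ : x₁ = 1 ∨ x₁ = -1)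
    (hy₀ : y₀ = 1 ∨ y₀ = -1) (hy₁ : y₁ = 1 ∨ y₁ = -1) (hτ₀ : τ₀ = 1 ∨ τ₀ = -1)
    (hτ₁ : τ₁ = 1 ∨ τ₁ = -1) (h : x₀ * y₀ + x₁ * y₁ = -(2 * τ₀ * τ₁)) :
    τ₁ * y₀ = -(τ₀ * x₀) ∧ τ₁ * y₁ = -(τ₀ * x₁) := by
  rcases hx₀ with rfl | rfl <;> rcases hx₁ with rfl | rfl <;> rcases hy₀ with rfl | rfl <;>
    rcases hy₁ with rfl | rfl <;> rcases hτ₀ with rfl | rfl <;> rcases hτ₁ with rfl | rfl <;>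
    first | (norm_num; done) | exact absurd h (by norm_num)

theorem mul_self_of_sign {x : ℂ} (h : x = 1 ∨ x = -1) : x * x = 1 := by
  rcases h with rfl | rfl <;> norm_num

theorem conj_of_sign {x : ℂ} (h : x = 1 ∨ x = -1) : conj x = x := by
  rcases h with rfl | rfl <;> simp

/-- If the labels from column `i` leaving the bottom row are switched to the negatives of those
leaving the top row, then column `i` contributes `2` (after switching) to the inner product of the
rows of the two vertices of column `i + 1`. -/
theorem columnSign_inner_left {n : Fin 2 → Fin 2 → ℕ → ℂ} {τ : ℂ}
    (hn : ∀ r r' i, n r r' i = 1 ∨ n r r' i = -1) (hτ : τ = 1 ∨ τ = -1) {i : ℕ}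
    (h : ∀ r, columnSign n τ i 1 * n 1 r i = -(columnSign n τ i 0 * n 0 r i)) :
    n 0 0 i * n 0 1 i + n 1 0 i * n 1 1 i =
      2 * columnSign n τ (i + 1) 0 * columnSign n τ (i + 1) 1 := by
  have h0 := mul_self_of_sign (columnSign_eq_one_or hn hτ i 0)
  have h1 := mul_self_of_sign (columnSign_eq_one_or hn hτ i 1)
  have e : n 1 0 i * n 1 1 i = n 0 0 i * n 0 1 i := by
    calc n 1 0 i * n 1 1 i
        = (columnSign n τ i 1 * n 1 0 i) * (columnSign n τ i 1 * n 1 1 i) := by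
          linear_combination -(n 1 0 i * n 1 1 i) * h1
      _ = n 0 0 i * n 0 1 i := by
          rw [h 0, h 1]; linear_combination (n 0 0 i * n 0 1 i) * h0
  rw [e]
  simp only [columnSign]
  linear_combination -2 * (n 0 0 i * n 0 1 i) * h0

/-- Orthogonality of the two rows of each column forces, after switching, the labels leaving the
bottom row to be the negatives of those leaving the top row. -/
theorem columnSign_mul_eq_neg {L : ℕ} {n : Fin 2 → Fin 2 → ℕ → ℂ} {τ : ℂ}
    (hn : ∀ r r' i, n r r' i = 1 ∨ n r r' i = -1) (hτ : τ = 1 ∨ τ = -1)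
    (h0 : 1 < L → 2 * τ + (n 0 0 0 * n 1 0 0 + n 0 1 0 * n 1 1 0) = 0)
    (hstep : ∀ i, i + 2 < L → (n 0 0 i * n 0 1 i + n 1 0 i * n 1 1 i) +
      (n 0 0 (i + 1) * n 1 0 (i + 1) + n 0 1 (i + 1) * n 1 1 (i + 1)) = 0) (i : ℕ)
    (hi : i + 1 < L) (r : Fin 2) :
    columnSign n τ i 1 * n 1 r i = -(columnSign n τ i 0 * n 0 r i) := by
  have hs := columnSign_eq_one_or hn hτ
  induction i generalizing r with
  | zero =>
    have := signs_mul_eq_neg (hn 0 0 0) (hn 0 1 0) (hn 1 0 0) (hn 1 1 0) (hs 0 0) (hs 0 1)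
      (by simp only [columnSign, if_true]; simpa using eq_neg_of_add_eq_zero_right (h0 hi))
    fin_cases r
    exacts [this.1, this.2]
  | succ i ih =>
    have hleft := columnSign_inner_left hn hτ (ih (by omega))
    have := signs_mul_eq_neg (hn 0 0 (i + 1)) (hn 0 1 (i + 1)) (hn 1 0 (i + 1)) (hn 1 1 (i + 1))
      (hs (i + 1) 0) (hs (i + 1) 1) (by linear_combination hstep i hi - hleft)
    fin_cases r
    exacts [this.1, this.2]

/-! ### Orthogonality of the two rows of a column -/

/-- The inner product of the rows of `A` belonging to the two vertices of column `i`, written as the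
contribution of the neighbours on the left plus that of the neighbours on the right. -/
theorem inner_rows_eq_zero {L : ℕ} {A : Matrix (TVertex L) (TVertex L) ℂ} (hA : A.IsHermitian)
    (hsq : A * A = 4) (hw : ∀ u v, A u v * conj (A u v) = formWeight L u v) {i : ℕ} (hi : i < L) :
    (if h : 0 < i then
        A (.inl (0, ⟨i, hi⟩)) (.inl (0, ⟨i - 1, by omega⟩)) *
            conj (A (.inl (1, ⟨i, hi⟩)) (.inl (0, ⟨i - 1, by omega⟩))) +
          A (.inl (0, ⟨i, hi⟩)) (.inl (1, ⟨i - 1, by omega⟩)) *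
            conj (A (.inl (1, ⟨i, hi⟩)) (.inl (1, ⟨i - 1, by omega⟩)))
      else A (.inl (0, ⟨i, hi⟩)) (.inr 0) * conj (A (.inl (1, ⟨i, hi⟩)) (.inr 0))) +
    (if h : i + 1 < L then
        A (.inl (0, ⟨i, hi⟩)) (.inl (0, ⟨i + 1, h⟩)) *
            conj (A (.inl (1, ⟨i, hi⟩)) (.inl (0, ⟨i + 1, h⟩))) +
          A (.inl (0, ⟨i, hi⟩)) (.inl (1, ⟨i + 1, h⟩)) *
            conj (A (.inl (1, ⟨i, hi⟩)) (.inl (1, ⟨i + 1, h⟩)))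
      else A (.inl (0, ⟨i, hi⟩)) (.inr 1) * conj (A (.inl (1, ⟨i, hi⟩)) (.inr 1))) = 0 := by
  rw [← sum_neighbours
    (fun w => A (.inl (0, ⟨i, hi⟩)) w * conj (A (.inl (1, ⟨i, hi⟩)) w)) 0 hi
    fun w hzero => by simp [apply_eq_zero_of_formWeight hw hzero]]
  have := congrFun (congrFun hsq (.inl (0, ⟨i, hi⟩))) (.inl (1, ⟨i, hi⟩))
  rw [Matrix.mul_apply] at this
  convert this using 1
  · refine Finset.sum_congr rfl fun w _ => ?_
    rw [← hA.apply w (.inl (1, ⟨i, hi⟩))]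
    rfl
  · rw [← Matrix.diagonal_ofNat 4, Matrix.diagonal_apply_ne _ (by simp)]

/-- The label from row `r` of column `i` to row `r'` of column `i + 1`, with the junk value `1`
when there is no column `i + 1`. -/
def rightLabel {L : ℕ} (A : Matrix (TVertex L) (TVertex L) ℂ) (r r' : Fin 2) (i : ℕ) : ℂ :=
  if h : i + 1 < L then A (.inl (r, ⟨i, by omega⟩)) (.inl (r', ⟨i + 1, h⟩)) else 1

theorem apply_right_eq_rightLabel {L : ℕ} (A : Matrix (TVertex L) (TVertex L) ℂ)
    (r r' : Fin 2) {i : ℕ} (h : i + 1 < L) :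
    A (.inl (r, ⟨i, by omega⟩)) (.inl (r', ⟨i + 1, h⟩)) = rightLabel A r r' i := by
  simp [rightLabel, h]

theorem rightLabel_eq_one_or {L : ℕ} {A : Matrix (TVertex L) (TVertex L) ℂ}
    (hw : ∀ u v, A u v * conj (A u v) = formWeight L u v)
    (hunit : ∀ u v, A u v * conj (A u v) = 1 → A u v = 1 ∨ A u v = -1) (r r' : Fin 2) (i : ℕ) :
    rightLabel A r r' i = 1 ∨ rightLabel A r r' i = -1 := by
  unfold rightLabel
  split_ifs with h
  · exact hunit _ _ (by rw [hw]; simp [formWeight])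
  · exact .inl rfl

theorem inner_rows_first {L : ℕ} {A : Matrix (TVertex L) (TVertex L) ℂ} (hA : A.IsHermitian)
    (hsq : A * A = 4) (hw : ∀ u v, A u v * conj (A u v) = formWeight L u v)
    (hunit : ∀ u v, A u v * conj (A u v) = 1 → A u v = 1 ∨ A u v = -1) (hL : 1 < L) :
    A (.inl (0, ⟨0, by omega⟩)) (.inr 0) * conj (A (.inl (1, ⟨0, by omega⟩)) (.inr 0)) +
      (rightLabel A 0 0 0 * rightLabel A 1 0 0 + rightLabel A 0 1 0 * rightLabel A 1 1 0) = 0 := by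
  have h := inner_rows_eq_zero hA hsq hw (i := 0) (by omega)
  rw [dif_neg (by omega), dif_pos (by omega)] at h
  simp only [apply_right_eq_rightLabel, conj_of_sign (rightLabel_eq_one_or hw hunit _ _ _)] at h
  exact h

theorem apply_left_eq_rightLabel {L : ℕ} {A : Matrix (TVertex L) (TVertex L) ℂ} (hA : A.IsHermitian)
    (hw : ∀ u v, A u v * conj (A u v) = formWeight L u v)
    (hunit : ∀ u v, A u v * conj (A u v) = 1 → A u v = 1 ∨ A u v = -1) (r r' : Fin 2) {i : ℕ}
    (h : i + 1 < L) :
    A (.inl (r', ⟨i + 1, h⟩)) (.inl (r, ⟨i, by omega⟩)) = rightLabel A r r' i := by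
  rw [← hA.apply, apply_right_eq_rightLabel A r r' h]
  exact conj_of_sign (rightLabel_eq_one_or hw hunit r r' i)

theorem inner_rows_middle {L : ℕ} {A : Matrix (TVertex L) (TVertex L) ℂ} (hA : A.IsHermitian)
    (hsq : A * A = 4) (hw : ∀ u v, A u v * conj (A u v) = formWeight L u v)
    (hunit : ∀ u v, A u v * conj (A u v) = 1 → A u v = 1 ∨ A u v = -1) {i : ℕ} (hi : i + 2 < L) :
    (rightLabel A 0 0 i * rightLabel A 0 1 i + rightLabel A 1 0 i * rightLabel A 1 1 i) +
      (rightLabel A 0 0 (i + 1) * rightLabel A 1 0 (i + 1) +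
        rightLabel A 0 1 (i + 1) * rightLabel A 1 1 (i + 1)) = 0 := by
  have h := inner_rows_eq_zero hA hsq hw (i := i + 1) (by omega)
  rw [dif_pos (by omega), dif_pos (by omega)] at h
  simp only [apply_right_eq_rightLabel, Nat.add_sub_cancel, apply_left_eq_rightLabel hA hw hunit,
    conj_of_sign (rightLabel_eq_one_or hw hunit _ _ _)] at h
  exact h

theorem inner_rows_last {m : ℕ} {A : Matrix (TVertex (m + 2)) (TVertex (m + 2)) ℂ}
    (hA : A.IsHermitian) (hsq : A * A = 4)
    (hw : ∀ u v, A u v * conj (A u v) = formWeight (m + 2) u v)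
    (hunit : ∀ u v, A u v * conj (A u v) = 1 → A u v = 1 ∨ A u v = -1) :
    (rightLabel A 0 0 m * rightLabel A 0 1 m + rightLabel A 1 0 m * rightLabel A 1 1 m) +
      A (.inl (0, ⟨m + 1, by omega⟩)) (.inr 1) *
        conj (A (.inl (1, ⟨m + 1, by omega⟩)) (.inr 1)) = 0 := by
  have h := inner_rows_eq_zero hA hsq hw (i := m + 1) (by omega)
  rw [dif_pos (by omega), dif_neg (by omega)] at h
  simp only [Nat.add_sub_cancel, apply_left_eq_rightLabel hA hw hunit,
    conj_of_sign (rightLabel_eq_one_or hw hunit _ _ _)] at h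
  exact h

/-! ### Switching to the standard matrix -/

/-- A matrix of the form `𝒯` with `A² = 4` whose two labels at the left end agree up to the sign `τ`
is switched to the standard matrix; by switching the end vertices as well, the end labels are
determined only up to sign. -/
theorem stronglyEquivalent_tMatrix {L : ℕ} (hL : 0 < L) {A : Matrix (TVertex L) (TVertex L) ℂ}
    (hA : A.IsHermitian) (hsq : A * A = 4)
    (hw : ∀ u v, A u v * conj (A u v) = formWeight L u v)
    (hunit : ∀ u v, A u v * conj (A u v) = 1 → A u v = 1 ∨ A u v = -1) {τ : ℂ}
    (hτ : τ = 1 ∨ τ = -1)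
    (hleft : A (.inl (1, ⟨0, hL⟩)) (.inr 0) = τ * A (.inl (0, ⟨0, hL⟩)) (.inr 0)) {α β : ℂ}
    (hα : A (.inl (0, ⟨0, hL⟩)) (.inr 0) = α ∨ A (.inl (0, ⟨0, hL⟩)) (.inr 0) = -α)
    (hβ : A (.inl (0, ⟨L - 1, by omega⟩)) (.inr 1) = β ∨
      A (.inl (0, ⟨L - 1, by omega⟩)) (.inr 1) = -β) :
    StronglyEquivalent A (tMatrix L α β) := by
  have hn := rightLabel_eq_one_or hw hunit
  set σ := columnSign (rightLabel A) τ with hσ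
  have hs : ∀ i r, σ i r = 1 ∨ σ i r = -1 := columnSign_eq_one_or hn hτ
  have ha : A (.inl (0, ⟨0, hL⟩)) (.inr 0) * conj (A (.inl (0, ⟨0, hL⟩)) (.inr 0)) = 2 := by
    rw [hw]; simp [formWeight]
  have hab : A (.inl (0, ⟨0, hL⟩)) (.inr 0) * conj (A (.inl (1, ⟨0, hL⟩)) (.inr 0)) = 2 * τ := by
    rw [hleft, map_mul, conj_of_sign hτ]; linear_combination τ * ha
  have hneg : ∀ i, i + 1 < L → ∀ r, σ i 1 * rightLabel A 1 r i = -(σ i 0 * rightLabel A 0 r i) :=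
    columnSign_mul_eq_neg hn hτ (fun h => hab ▸ inner_rows_first hA hsq hw hunit h)
      (fun i hi => inner_rows_middle hA hsq hw hunit hi)
  have hend : 2 * σ (L - 1) 0 * σ (L - 1) 1 + A (.inl (0, ⟨L - 1, by omega⟩)) (.inr 1) *
      conj (A (.inl (1, ⟨L - 1, by omega⟩)) (.inr 1)) = 0 := by
    obtain _ | _ | m := L
    · omega
    · have h := inner_rows_eq_zero hA hsq hw (i := 0) (by omega)
      rw [dif_neg (by omega), dif_neg (by omega), hab] at h
      simpa [hσ, columnSign] using h
    · have h := inner_rows_last hA hsq hw hunit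
      rw [columnSign_inner_left hn hτ (hneg m (by omega))] at h
      exact h
  have hc : A (.inl (1, ⟨L - 1, by omega⟩)) (.inr 1) *
      conj (A (.inl (1, ⟨L - 1, by omega⟩)) (.inr 1)) = 2 := by
    rw [hw]; simp [formWeight]; omega
  -- Multiply `hend` by the label from the last bottom vertex to the end, which has norm `2`.
  have hright : σ (L - 1) 1 * A (.inl (1, ⟨L - 1, by omega⟩)) (.inr 1) =
      -(σ (L - 1) 0 * A (.inl (0, ⟨L - 1, by omega⟩)) (.inr 1)) := by
    have h0 := mul_self_of_sign (hs (L - 1) 0)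
    linear_combination (σ (L - 1) 0 * A (.inl (1, ⟨L - 1, by omega⟩)) (.inr 1) / 2) * hend -
      (σ (L - 1) 1 * A (.inl (1, ⟨L - 1, by omega⟩)) (.inr 1)) * h0 -
      (σ (L - 1) 0 * A (.inl (0, ⟨L - 1, by omega⟩)) (.inr 1) / 2) * hc
  -- The signs of the two end vertices, chosen to turn the end labels into `α` and `β`.
  obtain ⟨π, hπ, hπα⟩ : ∃ π : ℂ, (π = 1 ∨ π = -1) ∧
      A (.inl (0, ⟨0, hL⟩)) (.inr 0) * π = α := by
    rcases hα with h | h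
    exacts [⟨1, .inl rfl, by rw [h]; ring⟩, ⟨-1, .inr rfl, by rw [h]; ring⟩]
  obtain ⟨κ, hκ, hκβ⟩ : ∃ κ : ℂ, (κ = 1 ∨ κ = -1) ∧
      σ (L - 1) 0 * A (.inl (0, ⟨L - 1, by omega⟩)) (.inr 1) * κ = β := by
    rcases hs (L - 1) 0 with h' | h' <;> rcases hβ with h | h
    exacts [⟨1, .inl rfl, by rw [h, h']; ring⟩, ⟨-1, .inr rfl, by rw [h, h']; ring⟩,
      ⟨-1, .inr rfl, by rw [h, h']; ring⟩, ⟨1, .inl rfl, by rw [h, h']; ring⟩]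
  let s : TVertex L → ℂ := Sum.elim (fun u => σ u.2 u.1) (fun e => if e = 0 then π else κ)
  have hss : ∀ v, s v = 1 ∨ s v = -1 := by
    rintro (u | e)
    · exact hs _ _
    · simp only [s, Sum.elim_inr]; split_ifs <;> assumption
  -- The entries with the two vertices exchanged follow, as both matrices are Hermitian.
  have hherm : ∀ u v, s u * A u v * s v = tMatrix L α β u v →
      s v * A v u * s u = tMatrix L α β v u := by
    intro u v h
    rw [← hA.apply v u, ← (tMatrix_isHermitian L α β).apply v u, ← h]
    simp only [star_mul', Complex.star_def, conj_of_sign (hss u), conj_of_sign (hss v)]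
    ring
  have hcyl : ∀ (r r' : Fin 2) (i : ℕ) (h : i + 1 < L),
      σ i r * rightLabel A r r' i * σ (i + 1) r' = rowSign r := by
    intro r r' i h
    have h0 := mul_self_of_sign (hs i 0)
    have h1 := mul_self_of_sign (hn 0 r' i)
    have hsucc : σ (i + 1) r' = σ i 0 * rightLabel A 0 r' i := rfl
    fin_cases r
    · simp only [hsucc, rowSign, Fin.zero_eta, if_true]
      linear_combination rightLabel A 0 r' i * rightLabel A 0 r' i * h0 + h1
    · simp only [hsucc, rowSign, Fin.mk_one, one_ne_zero, if_false, hneg i h r']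
      linear_combination -(rightLabel A 0 r' i * rightLabel A 0 r' i) * h0 - h1
  have hblock : ∀ (u : Fin 2 × Fin L) (e : Fin 2),
      s (.inl u) * A (.inl u) (.inr e) * s (.inr e) = tMatrix L α β (.inl u) (.inr e) := by
    rintro ⟨r, i, hi⟩ e
    by_cases hzero : formWeight L (.inl (r, ⟨i, hi⟩)) (.inr e) = 0
    · rw [apply_eq_zero_of_formWeight hw hzero]
      fin_cases e <;> simp [formWeight] at hzero <;> simp [tMatrix, endMatrix, hzero]
    · fin_cases e
      · obtain rfl : i = 0 := by simpa [formWeight] using hzero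
        fin_cases r
        · simp [s, tMatrix, endMatrix, hσ, columnSign, hπα]
        · simp [s, tMatrix, endMatrix, hσ, columnSign, hleft]
          linear_combination A (.inl (0, ⟨0, hL⟩)) (.inr 0) * π * mul_self_of_sign hτ + hπα
      · obtain rfl : i = L - 1 := by simp [formWeight] at hzero; omega
        have hL1 : L - 1 + 1 = L := by omega
        fin_cases r
        · simp [s, tMatrix, endMatrix, rowSign, hL1, hκβ]
        · simp [s, tMatrix, endMatrix, rowSign, hL1, hright, hκβ]
  refine ⟨Equiv.refl _, s, hss, ?_⟩
  ext u v
  rw [Matrix.submatrix_apply, Matrix.mul_diagonal, Matrix.diagonal_mul]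
  symm
  simp only [Equiv.refl_apply]
  rcases u with ⟨r, i, hi⟩ | e <;> rcases v with ⟨r', j, hj⟩ | f
  · by_cases h1 : i + 1 = j
    · subst h1
      rw [show tMatrix L α β (.inl (r, ⟨i, hi⟩)) (.inl (r', ⟨i + 1, hj⟩)) = rowSign r by
        simp [tMatrix, cylinderMatrix], apply_right_eq_rightLabel A r r' hj]
      exact hcyl r r' i hj
    · by_cases h2 : j + 1 = i
      · subst h2
        apply hherm
        rw [show tMatrix L α β (.inl (r', ⟨j, hj⟩)) (.inl (r, ⟨j + 1, hi⟩)) = rowSign r' by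
          simp [tMatrix, cylinderMatrix], apply_right_eq_rightLabel A r' r hi]
        exact hcyl r' r j hi
      · rw [apply_eq_zero_of_formWeight hw (by simp [formWeight, h1, h2])]
        simp [tMatrix, cylinderMatrix, h1, h2]
  · exact hblock _ _
  · exact hherm _ _ (hblock _ _)
  · rw [apply_eq_zero_of_formWeight hw (by simp [formWeight])]
    simp [tMatrix]

/-! ### Strong equivalence and the standard matrices -/

theorem StronglyEquivalent.of_submatrix {V W U : Type*} [Fintype V] [DecidableEq V] [Fintype W]
    [DecidableEq W] {A : Matrix V V ℂ} {B : Matrix U U ℂ} (e : W ≃ V)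
    (h : StronglyEquivalent (A.submatrix e e) B) : StronglyEquivalent A B := by
  obtain ⟨σ, s, hs, rfl⟩ := h
  refine ⟨σ.trans e, s ∘ e.symm, fun v => hs _, ?_⟩
  ext u v
  simp [Matrix.mul_diagonal, Matrix.diagonal_mul]

theorem StronglyEquivalent.map_conj {V W : Type*} [Fintype V] [DecidableEq V]
    {A : Matrix V V ℂ} {B : Matrix W W ℂ} (h : StronglyEquivalent A B) :
    StronglyEquivalent (A.map conj) (B.map conj) := by
  obtain ⟨σ, s, hs, rfl⟩ := h
  refine ⟨σ, s, hs, ?_⟩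
  ext u v
  simp [Matrix.mul_diagonal, Matrix.diagonal_mul, conj_of_sign (hs _)]

theorem tMatrix_map_conj (L : ℕ) (α β : ℂ) :
    (tMatrix L α β).map conj = tMatrix L (conj α) (conj β) := by
  have hcyl : ∀ u v, conj (cylinderMatrix L u v) = cylinderMatrix L u v := by
    intro u v
    unfold cylinderMatrix
    split_ifs <;> simp [rowSign_conj]
  have hend : ∀ u e, conj (endMatrix L α β u e) = endMatrix L (conj α) (conj β) u e := by
    intro u e
    unfold endMatrix
    split_ifs <;> simp [rowSign_conj]
  ext (u | e) (v | f)
  · simpa [tMatrix] using hcyl u v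
  · simpa [tMatrix] using hend u f
  · simp [tMatrix, ← hend]
  · simp [tMatrix]

/-- Switching the right end vertex negates the right end label. For `d = -2`, where `ω̄ = -ω`, this
identifies the matrices with end labels `ω, ω` and `ω, ω̄`. -/
theorem StronglyEquivalent.tMatrix_neg_right {V : Type*} [Fintype V] [DecidableEq V]
    {A : Matrix V V ℂ} {L : ℕ} {α β : ℂ} (h : StronglyEquivalent A (tMatrix L α (-β))) :
    StronglyEquivalent A (tMatrix L α β) := by
  obtain ⟨σ, s, hs, h⟩ := h
  let ε : TVertex L → ℂ := Sum.elim (fun _ => 1) (fun e => if e = 0 then 1 else -1)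
  have hε : ∀ v, ε v = 1 ∨ ε v = -1 := by
    rintro (u | e)
    · exact .inl rfl
    · simp only [ε, Sum.elim_inr]; split_ifs <;> simp
  refine ⟨σ, fun v => s v * ε (σ.symm v), fun v => ?_, ?_⟩
  · rcases hs v with h | h <;> rcases hε (σ.symm v) with h' | h' <;> simp [h, h']
  · have hent : ∀ u v, tMatrix L α β u v = ε u * tMatrix L α (-β) u v * ε v := by
      rintro (u | e) (v | f)
      · simp [tMatrix, ε]
      · by_cases hf : f = 0
        · simp [tMatrix, ε, endMatrix, hf]
        simp [tMatrix, ε, endMatrix, hf]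
        split_ifs <;> simp
      · by_cases he : e = 0 <;> simp [tMatrix, ε, endMatrix, he, apply_ite conj]
      · simp [tMatrix]
    ext u v
    rw [hent, h]
    simp only [Matrix.submatrix_apply, Matrix.mul_diagonal, Matrix.diagonal_mul,
      Equiv.symm_apply_apply]
    ring

/-- `A` is one of the matrices `T(ω, ω)`, `T(ω, ω̄)` up to switching, relabelling and complex
conjugation. -/
def IsStandardUpToConj {V : Type*} [Fintype V] [DecidableEq V] (A : Matrix V V ℂ) (L : ℕ) (ω : ℂ) :
    Prop :=
  ∃ β, (β = ω ∨ β = conj ω) ∧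
    (StronglyEquivalent A (tMatrix L ω β) ∨ StronglyEquivalent (A.map conj) (tMatrix L ω β))

theorem IsStandardUpToConj.of_submatrix {V W : Type*} [Fintype V] [DecidableEq V] [Fintype W]
    [DecidableEq W] {A : Matrix V V ℂ} {L : ℕ} {ω : ℂ} (e : W ≃ V)
    (h : IsStandardUpToConj (A.submatrix e e) L ω) : IsStandardUpToConj A L ω := by
  obtain ⟨β, hβ, h | h⟩ := h
  · exact ⟨β, hβ, .inl (h.of_submatrix e)⟩
  · exact ⟨β, hβ, .inr (StronglyEquivalent.of_submatrix e h)⟩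

theorem sq_eq_or_of_mem {ω x : ℂ} (hx : x = ω ∨ x = -ω ∨ x = conj ω ∨ x = -conj ω) :
    x ^ 2 = ω ^ 2 ∨ x ^ 2 = conj ω ^ 2 := by
  rcases hx with rfl | rfl | rfl | rfl <;> simp

/-- The case where the two labels at the left end agree up to sign. Conjugation makes the left end
label `ω`. -/
theorem isStandardUpToConj_of_left {L : ℕ} (hL : 0 < L) {A : Matrix (TVertex L) (TVertex L) ℂ}
    (hA : A.IsHermitian) (hsq : A * A = 4)
    (hw : ∀ u v, A u v * conj (A u v) = formWeight L u v)
    (hunit : ∀ u v, A u v * conj (A u v) = 1 → A u v = 1 ∨ A u v = -1) {ω : ℂ}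
    (htwo : ∀ u v, A u v * conj (A u v) = 2 →
      A u v = ω ∨ A u v = -ω ∨ A u v = conj ω ∨ A u v = -conj ω)
    (hleft : A (.inl (1, ⟨0, hL⟩)) (.inr 0) ^ 2 = A (.inl (0, ⟨0, hL⟩)) (.inr 0) ^ 2) :
    IsStandardUpToConj A L ω := by
  obtain ⟨τ, hτ, hleft⟩ : ∃ τ : ℂ, (τ = 1 ∨ τ = -1) ∧
      A (.inl (1, ⟨0, hL⟩)) (.inr 0) = τ * A (.inl (0, ⟨0, hL⟩)) (.inr 0) := by
    rcases sq_eq_sq_iff_eq_or_eq_neg.1 hleft with h | h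
    exacts [⟨1, .inl rfl, by rw [h, one_mul]⟩, ⟨-1, .inr rfl, by rw [h, neg_one_mul]⟩]
  have hp := sq_eq_or_of_mem (htwo (.inl (0, ⟨0, hL⟩)) (.inr 0) (by rw [hw]; simp [formWeight]))
  have hq := sq_eq_or_of_mem (htwo (.inl (0, ⟨L - 1, by omega⟩)) (.inr 1)
    (by rw [hw]; simp [formWeight]; omega))
  simp only [sq_eq_sq_iff_eq_or_eq_neg] at hp hq
  have key := fun α β => stronglyEquivalent_tMatrix (α := α) (β := β) hL hA hsq hw hunit hτ hleft
  rcases hp with hp | hp <;> rcases hq with hq | hq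
  · exact ⟨ω, .inl rfl, .inl (key _ _ hp hq)⟩
  · exact ⟨conj ω, .inr rfl, .inl (key _ _ hp hq)⟩
  · refine ⟨conj ω, .inr rfl, .inr ?_⟩
    simpa [tMatrix_map_conj] using (key _ _ hp hq).map_conj
  · refine ⟨ω, .inl rfl, .inr ?_⟩
    simpa [tMatrix_map_conj] using (key _ _ hp hq).map_conj

theorem sq_eq_of_two_mul_eq_neg {a b x y : ℂ} (ha : a ≠ 0) (hx : x = 1 ∨ x = -1)
    (hy : y = 1 ∨ y = -1) (h : 2 * a = -((x + y) * b)) : b ^ 2 = a ^ 2 := by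
  rcases hx with rfl | rfl <;> rcases hy with rfl | rfl
  · rw [show a = -b by linear_combination h / 2]; ring
  · exact absurd (by linear_combination h / 2) ha
  · exact absurd (by linear_combination h / 2) ha
  · rw [show a = b by linear_combination h / 2]

/-! ### The labels at the left end -/

/-- For four elements `±ω, ±ω̄` arranged as a `2 × 2` matrix with orthogonal rows, the entries of the
first column or those of the first row agree up to sign. -/
theorem sq_eq_or_sq_eq_of_orthogonal {ω x₀ x₁ y₀ y₁ : ℂ} (hω : ω ^ 2 + conj ω ^ 2 ≠ 0)
    (hx₀ : x₀ ^ 2 = ω ^ 2 ∨ x₀ ^ 2 = conj ω ^ 2) (hx₁ : x₁ ^ 2 = ω ^ 2 ∨ x₁ ^ 2 = conj ω ^ 2)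
    (hy₀ : y₀ ^ 2 = ω ^ 2 ∨ y₀ ^ 2 = conj ω ^ 2) (hy₁ : y₁ ^ 2 = ω ^ 2 ∨ y₁ ^ 2 = conj ω ^ 2)
    (h : x₀ * conj x₁ + y₀ * conj y₁ = 0) : x₁ ^ 2 = x₀ ^ 2 ∨ y₀ ^ 2 = x₀ ^ 2 := by
  have hsq : x₀ ^ 2 * conj (x₁ ^ 2) = y₀ ^ 2 * conj (y₁ ^ 2) := by
    simp only [map_pow]
    linear_combination (x₀ * conj x₁ - y₀ * conj y₁) * h
  by_cases hc : ω ^ 2 = conj ω ^ 2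
  · left
    rw [← hc] at hx₀ hx₁
    rw [hx₀.elim id id, hx₁.elim id id]
  have h0 : ω ^ 2 ≠ 0 := fun h0 => hω (by
    have : ω = 0 := by simpa using h0
    simp [this])
  have h0' : conj ω ^ 2 ≠ 0 := by simpa using h0
  have hne : ω ^ 2 * ω ^ 2 ≠ conj ω ^ 2 * conj ω ^ 2 := fun h => by
    have : (ω ^ 2 - conj ω ^ 2) * (ω ^ 2 + conj ω ^ 2) = 0 := by linear_combination h
    rcases mul_eq_zero.1 this with h | h
    exacts [hc (sub_eq_zero.1 h), hω h]
  -- Only the cases with `x₁² ≠ x₀²` and `y₀² ≠ x₀²` survive the last `simp only`.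
  rcases hx₀ with e₀ | e₀ <;> rcases hx₁ with e₁ | e₁ <;> rcases hy₀ with f₀ | f₀ <;>
    rcases hy₁ with f₁ | f₁ <;> rw [e₀, e₁, f₀, f₁] at hsq <;>
    simp only [map_pow, Complex.conj_conj] at hsq <;> simp only [e₀, e₁, f₀, true_or, or_true]
  · exact absurd hsq hne
  · exact absurd (mul_right_cancel₀ h0 hsq) hc
  · exact absurd (mul_right_cancel₀ h0' hsq).symm hc
  · exact absurd hsq.symm hne

/-- The symmetry of the form with one column that exchanges the column with the pair of end
vertices. -/
def swapEnds : TVertex 1 ≃ TVertex 1 where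
  toFun := Sum.elim (fun u => .inr u.1) (fun r => .inl (r, 0))
  invFun := Sum.elim (fun u => .inr u.1) (fun r => .inl (r, 0))
  left_inv := by rintro (⟨r, i⟩ | r) <;> simp [Fin.fin_one_eq_zero]
  right_inv := by rintro (⟨r, i⟩ | r) <;> simp [Fin.fin_one_eq_zero]

theorem formWeight_swapEnds (u v : TVertex 1) :
    formWeight 1 (swapEnds u) (swapEnds v) = formWeight 1 u v := by
  revert u v; decide

/-- If there are at least two columns, the inner product of the rows of the first column is
`a ā' + (x + y)` with signs `x`, `y`, so that `a' = ±a` for the two left end labels `a`, `a'`. With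
only one column this may fail, but then it holds after exchanging the column with the ends. -/
theorem isStandardUpToConj_of_mul_self {L : ℕ} (hL : 0 < L)
    {A : Matrix (TVertex L) (TVertex L) ℂ} (hA : A.IsHermitian) (hsq : A * A = 4)
    (hw : ∀ u v, A u v * conj (A u v) = formWeight L u v)
    (hunit : ∀ u v, A u v * conj (A u v) = 1 → A u v = 1 ∨ A u v = -1) {ω : ℂ}
    (htwo : ∀ u v, A u v * conj (A u v) = 2 →
      A u v = ω ∨ A u v = -ω ∨ A u v = conj ω ∨ A u v = -conj ω)
    (hω : ω ^ 2 + conj ω ^ 2 ≠ 0) : IsStandardUpToConj A L ω := by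
  by_cases hL1 : 1 < L
  · refine isStandardUpToConj_of_left hL hA hsq hw hunit htwo ?_
    have h := inner_rows_first hA hsq hw hunit hL1
    have ha : A (.inl (0, ⟨0, hL⟩)) (.inr 0) * conj (A (.inl (0, ⟨0, hL⟩)) (.inr 0)) = 2 := by
      rw [hw]; simp [formWeight]
    have hb : A (.inl (1, ⟨0, hL⟩)) (.inr 0) * conj (A (.inl (1, ⟨0, hL⟩)) (.inr 0)) = 2 := by
      rw [hw]; simp [formWeight]
    have hn := rightLabel_eq_one_or hw hunit
    have hsign : ∀ x y : ℂ, (x = 1 ∨ x = -1) → (y = 1 ∨ y = -1) → (x * y = 1 ∨ x * y = -1) := by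
      rintro x y (rfl | rfl) (rfl | rfl) <;> simp
    refine sq_eq_of_two_mul_eq_neg (left_ne_zero_of_mul (ha.trans_ne two_ne_zero))
      (hsign _ _ (hn 0 0 0) (hn 1 0 0)) (hsign _ _ (hn 0 1 0) (hn 1 1 0)) ?_
    linear_combination A (.inl (1, ⟨0, hL⟩)) (.inr 0) * h -
      A (.inl (0, ⟨0, hL⟩)) (.inr 0) * hb
  · obtain rfl : L = 1 := by omega
    have hmem : ∀ r e, A (.inl (r, 0)) (.inr e) ^ 2 = ω ^ 2 ∨
        A (.inl (r, 0)) (.inr e) ^ 2 = conj ω ^ 2 := fun r e =>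
      sq_eq_or_of_mem (htwo _ _ (by rw [hw]; simp [formWeight]))
    have h := inner_rows_eq_zero hA hsq hw (i := 0) one_pos
    rw [dif_neg (by omega), dif_neg (by omega)] at h
    rcases sq_eq_or_sq_eq_of_orthogonal hω (hmem 0 0) (hmem 1 0) (hmem 0 1) (hmem 1 1) h
      with h | h
    · exact isStandardUpToConj_of_left hL hA hsq hw hunit htwo h
    · apply IsStandardUpToConj.of_submatrix swapEnds
      refine isStandardUpToConj_of_left hL (hA.submatrix _) (submatrix_mul_self_eq_four hsq _)
        (fun u v => ?_) (fun _ _ => hunit _ _) (fun _ _ => htwo _ _) ?_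
      · rw [← formWeight_swapEnds]; exact hw _ _
      · show A (.inr 1) (.inl (0, 0)) ^ 2 = A (.inr 0) (.inl (0, 0)) ^ 2
        rw [← hA.apply, ← hA.apply (.inr 0), ← star_pow, ← star_pow, h]

/-! ### Classification -/

theorem mainTheorem8 (d : ℤ) (hd : d = -2 ∨ d = -7 ∨ d = -11 ∨ d = -15) (k : ℕ) (hk : 2 ≤ k)
    {V : Type*} [Fintype V] [DecidableEq V] (G : LGraph d V)
    (hcyc : G.IsCyclotomic) (hform : G.IsOfFormT k) :
    ∃ h : d = -2 ∨ d = -7,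
      G.Equivalent (T4 d h k) ∨ (d = -7 ∧ G.Equivalent (T4' d h k)) := by
  obtain ⟨e, he⟩ := hform
  have hL : 0 < k - 1 := by omega
  have htwo : ∀ u v, G.adj u v * conj (G.adj u v) = 2 → _ := fun u v h =>
    mem_normLabels_two hd
      (mem_normLabels_of_mem_labelSet two_ne_zero (G.label_mem u v) (by exact_mod_cast h))
  have hd' : d = -2 ∨ d = -7 :=
    (htwo (e (.inl (0, ⟨0, hL⟩))) (e (.inr 0)) (by rw [he]; simp [formWeight])).1
  have hrow : ∀ u, ∑ v, G.adj u v * conj (G.adj u v) = 4 := fun u => by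
    rw [← sum_formWeight hL (e.symm u), ← e.sum_comp]
    exact Finset.sum_congr rfl fun v _ => by rw [← he, e.apply_symm_apply]
  have hsq := sq_eq_four_of_eigenvalues_mem_Icc G.isHermitian hcyc hrow
  have hstd : IsStandardUpToConj G.adj (k - 1) (omega d) :=
    .of_submatrix e <| isStandardUpToConj_of_mul_self hL (G.isHermitian.submatrix e)
      (submatrix_mul_self_eq_four hsq e) he
      (fun u v h => eq_one_or_neg_one_of_mem_normLabels_one hd
        (mem_normLabels_of_mem_labelSet one_ne_zero (G.label_mem _ _) (by exact_mod_cast h)))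
      (fun u v h => (htwo _ _ h).2) (omega_sq_add_conj_sq_ne_zero hd')
  refine ⟨hd', ?_⟩
  obtain ⟨β, rfl | rfl, h⟩ := hstd
  · exact .inl (h.elim .inl fun h => .inr (.inr (.inl h)))
  · by_cases h7 : d = -7
    · exact .inr ⟨h7, h.elim .inl fun h => .inr (.inr (.inl h))⟩
    · obtain rfl : d = -2 := by omega
      have hconj : conj (omega (-2)) = -omega (-2) := by simp [omega, sqrtNeg_conj]
      rw [hconj] at h
      exact .inl (h.elim (fun h => .inl h.tMatrix_neg_right)
        fun h => .inr (.inr (.inl h.tMatrix_neg_right)))
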